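/- **Theorem 1 (Privacy guarantee).** Setting. Let $L(\theta,x)$ be a loss with parameter $\theta\in\mathbb R^D$ and data point $x\in\mathbb R^m$; fix $\theta$ and let $g(x)=\nabla_\theta L(\theta,x)\in\mathbb R^D$. A set $S$ of the $D$ gradient coordinates is encrypted; put $z=|S|/D$ and $d=D-|S|=D(1-z)$. Let $R:\mathbb R^D\to\mathbb R^d$ delete the encrypted coordinates and let $P:\mathbb R^d\to\mathbb R^D$ put zeros in their place. The attacker observes $y=Pu$, $u=Rg(x)+\delta$, with $\delta\sim\mathcal N(0,\sigma^2I_d)$ independent of $x$, $\sigma>0$; write $p(u\mid x)$ for the density of $\mathcal N(Rg(x),\sigma^2I_d)$. The data point $x$ has a law $\mathcal X$ on $\mathbb R^m$ with a density $p$ that is positive on an open set $\Omega$ ($\Omega=\mathbb R^m$ is allowed) and zero outside it. The partial derivatives with respect to $x$ of $p$ and of the unencrypted coordinates of $g$ exist on $\Omega$, and the prior Fisher information $J_P=\mathbb E_x[\nabla\log p(x)\,\nabla\log p(x)^\top]$ is finite. Let $\lambda_1(J_P)$ be its largest eigenvalue, let $\|R\nabla_xg(x)\|_{\max}$ be the largest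 absolute value of an entry of the $d\times m$ matrix $R\nabla_xg(x)$, and put $$\beta=\frac{m}{\frac{D(1-z)}{\sigma^2}\,\mathbb E_x\|R\nabla_xg(x)\|_{\max}^2+\lambda_1(J_P)}\in[0,\infty],$$ where $\beta=0$ if the expectation is infinite and $d>0$, and $\beta=\infty$ if $m>0$ and the denominator is $0$. For measurable $A:\mathbb R^D\to\mathbb R^m$ let $\mathrm{MSE}(A)=\mathbb E_x\mathbb E_{y\mid x}\|A(y)-x\|_2^2$. Claim. (i) If $p(x)\to0$ whenever $x\in\Omega$ tends to a boundary point of $\Omega$ (no condition if $\Omega=\mathbb R^m$), then the reconstruction error $E_A=\inf_A\mathrm{MSE}(A)$, the infimum being over all measurable $A:\mathbb R^D\to\mathbb R^m$, satisfies $E_A\ge\beta$. (ii) Without that condition on $p$, $\mathrm{MSE}(A)\ge\beta$ holds for every measurable $A$ that satisfies the following regularity conditions: the bias $B(x)=\int(A(Pu)-x)\,p(u\mid x)\,du$ is finite for every $x\in\Omega$; differentiation in $x$ and integration in $u$ may be interchanged in $\nabla_x\int p(x)p(u\mid x)(A(Pu)-x)^\top du$ for every $x\in\Omega$ (the integral on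 the right-hand side being absolutely convergent); and $B(x)p(x)\to0$ as $x\in\Omega$ tends to a boundary point of $\Omega$. -/

import Mathlib

open MeasureTheory ProbabilityTheory Filter Topology
open scoped ENNReal

noncomputable section

namespace SelectiveEncryption

/-- Real Euclidean `n`-space with the Euclidean norm. -/
abbrev Eu (n : ℕ) : Type := EuclideanSpace ℝ (Fin n)

/-- The space `ℝ^d` of the unencrypted coordinates; `S` is the set of encrypted ones. -/
abbrev Unenc {D : ℕ} (S : Finset (Fin D)) : Type := EuclideanSpace ℝ {j : Fin D // j ∉ S}

/-- The restriction operator `R`: it deletes the encrypted coordinates. -/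
def restrictOp {D : ℕ} (S : Finset (Fin D)) (v : Eu D) : Unenc S :=
  WithLp.toLp 2 fun j => v j.1

/-- The prolongation operator `P`: it puts zeros at the encrypted coordinates. -/
def prolongOp {D : ℕ} (S : Finset (Fin D)) (u : Unenc S) : Eu D :=
  WithLp.toLp 2 fun j => if h : j ∉ S then u ⟨j, h⟩ else 0

/-- The encryption ratio `z = (D - d) / D`, the fraction of encrypted coordinates. -/
def encryptionRatio {D : ℕ} (S : Finset (Fin D)) : ℝ := (S.card : ℝ) / (D : ℝ)

/-- The model gradient `g(x) = ∇_θ L(θ, x)` at the parameter `θ`. -/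
def modelGradient {m D : ℕ} (L : Eu D → Eu m → ℝ) (θ : Eu D) (x : Eu m) : Eu D :=
  gradient (fun θ' => L θ' x) θ

/-- The partial derivative `∂f/∂x_i` at `x`. -/
def partialDeriv {m : ℕ} (i : Fin m) (f : Eu m → ℝ) (x : Eu m) : ℝ :=
  lineDeriv ℝ f x (EuclideanSpace.single i (1 : ℝ))

/-- The partial derivative `∂f/∂x_i` at `x` exists. -/
def HasPartial {m : ℕ} (i : Fin m) (f : Eu m → ℝ) (x : Eu m) : Prop :=
  LineDifferentiableAt ℝ f x (EuclideanSpace.single i (1 : ℝ))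

/-- The law of the noise `δ ~ N(0, σ² I)` on the unencrypted coordinates. -/
def noise {D : ℕ} (S : Finset (Fin D)) (σ : ℝ) : Measure (Unenc S) :=
  multivariateGaussian 0 ((σ ^ 2) • (1 : Matrix {j : Fin D // j ∉ S} {j : Fin D // j ∉ S} ℝ))

/-- The law of `y = P (R v + δ)`, the attacker's view of the gradient vector `v`. -/
def observation {D : ℕ} (S : Finset (Fin D)) (σ : ℝ) (v : Eu D) : Measure (Eu D) :=
  (noise S σ).map fun δ => prolongOp S (restrictOp S v + δ)

/-- The density at `u` of `N(R v, σ² I)`, i.e. the likelihood of `u = R v + δ`. -/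
def likelihood {D : ℕ} (S : Finset (Fin D)) (σ : ℝ) (v : Eu D) (u : Unenc S) : ℝ :=
  (Real.sqrt (2 * Real.pi * σ ^ 2) ^ (D - S.card))⁻¹ *
    Real.exp (-‖u - restrictOp S v‖ ^ 2 / (2 * σ ^ 2))

/-- The data distribution with Lebesgue density `p`. -/
def dataLaw {m : ℕ} (p : Eu m → ℝ) : Measure (Eu m) :=
  volume.withDensity fun x => ENNReal.ofReal (p x)

/-- The mean squared error `E_x E_{y ~ S(g(x))} ‖A(y) - x‖²` of the estimator `A`. -/
def meanSquaredError {m D : ℕ} (p : Eu m → ℝ) (g : Eu m → Eu D) (S : Finset (Fin D)) (σ : ℝ)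
    (A : Eu D → Eu m) : ℝ≥0∞ :=
  ∫⁻ x, ∫⁻ y, ENNReal.ofReal (‖A y - x‖ ^ 2) ∂(observation S σ (g x)) ∂(dataLaw p)

/-- The reconstruction error `E_A`: the least mean squared error over all (measurable)
reconstruction maps `A : ℝ^D → ℝ^m`. -/
def reconstructionError {m D : ℕ} (p : Eu m → ℝ) (g : Eu m → Eu D) (S : Finset (Fin D))
    (σ : ℝ) : ℝ≥0∞ :=
  ⨅ (A : Eu D → Eu m) (_ : Measurable A), meanSquaredError p g S σ A

/-- The `i`-th component of the score `∇_x log p(x)` of the data density. -/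
def score {m : ℕ} (p : Eu m → ℝ) (i : Fin m) (x : Eu m) : ℝ :=
  partialDeriv i (fun x' => Real.log (p x')) x

/-- The prior Fisher information `J_P = E_x[∇ log p(x) ∇ log p(x)ᵀ]`. -/
def priorFisher {m : ℕ} (p : Eu m → ℝ) : Matrix (Fin m) (Fin m) ℝ :=
  Matrix.of fun i k => ∫ x, score p i x * score p k x ∂(dataLaw p)

/-- The largest eigenvalue `λ₁` of a real symmetric matrix. -/
def lambdaMax {m : ℕ} (J : Matrix (Fin m) (Fin m) ℝ) : ℝ := sSup (spectrum ℝ J)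

/-- The matrix `R ∇_x g(x)`, with entries `∂g_j/∂x_i` for the unencrypted `j`. -/
def restrictedJacobian {m D : ℕ} (g : Eu m → Eu D) (S : Finset (Fin D)) (x : Eu m) :
    Matrix {j : Fin D // j ∉ S} (Fin m) ℝ :=
  Matrix.of fun j i => partialDeriv i (fun x' => g x' j.1) x

/-- `‖M‖²_max`, the square of the largest absolute value of an entry. -/
def maxNormSq {ι κ : Type} (M : Matrix ι κ ℝ) : ℝ := (⨆ q : ι × κ, |M q.1 q.2|) ^ 2

/-- The lower bound
`m / (D (1 - z) / σ² * E_x ‖R ∇_x g(x)‖²_max + λ₁(J_P))`, in `[0, ∞]`. -/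
def privacyBound {m D : ℕ} (p : Eu m → ℝ) (g : Eu m → Eu D) (S : Finset (Fin D)) (σ : ℝ) :
    ℝ≥0∞ :=
  (m : ℝ≥0∞) /
    (ENNReal.ofReal ((D : ℝ) * (1 - encryptionRatio S) / σ ^ 2) *
        (∫⁻ x, ENNReal.ofReal (maxNormSq (restrictedJacobian g S x)) ∂(dataLaw p)) +
      ENNReal.ofReal (lambdaMax (priorFisher p)))

/-- `p(x, u) (A(P u) - x)_k`: the joint density of `(x, u)` times a component of the
estimation error. -/
def weightedError {m D : ℕ} (p : Eu m → ℝ) (g : Eu m → Eu D) (S : Finset (Fin D)) (σ : ℝ)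
    (A : Eu D → Eu m) (k : Fin m) (x : Eu m) (u : Unenc S) : ℝ :=
  p x * likelihood S σ (g x) u * (A (prolongOp S u) - x) k

/-- The bias `B(x) = ∫ (A(P u) - x) p(u | x) du`. -/
def bias {m D : ℕ} (g : Eu m → Eu D) (S : Finset (Fin D)) (σ : ℝ)
    (A : Eu D → Eu m) (x : Eu m) : Eu m :=
  ∫ u, likelihood S σ (g x) u • (A (prolongOp S u) - x)

/-- The regularity conditions of the Bayesian Cramér–Rao bound that concern the estimator `A`:
finite bias, interchange of derivative and integral, and vanishing of `B(x) p(x)` at the boundary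
of the region `Ω` on which the data density lives. -/
structure RegularEstimator {m D : ℕ} (Ω : Set (Eu m)) (p : Eu m → ℝ) (g : Eu m → Eu D)
    (S : Finset (Fin D)) (σ : ℝ) (A : Eu D → Eu m) : Prop where
  measurable : Measurable A
  finite_bias : ∀ x ∈ Ω,
    Integrable fun u : Unenc S => likelihood S σ (g x) u • (A (prolongOp S u) - x)
  integrable_deriv : ∀ x ∈ Ω, ∀ i k : Fin m,
    Integrable fun u : Unenc S => partialDeriv i (fun x' => weightedError p g S σ A k x' u) x
  interchange : ∀ x ∈ Ω, ∀ i k : Fin m,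
    HasLineDerivAt ℝ (fun x' => ∫ u : Unenc S, weightedError p g S σ A k x' u)
      (∫ u : Unenc S, partialDeriv i (fun x' => weightedError p g S σ A k x' u) x)
      x (EuclideanSpace.single i (1 : ℝ))
  boundary : ∀ x₀ ∈ frontier Ω, Tendsto (fun x => p x • bias g S σ A x) (𝓝[Ω] x₀) (𝓝 0)

end SelectiveEncryption

end

open SelectiveEncryption

/-! This is the Bayesian Cramér–Rao (van Trees) inequality. Let w(x,u) = p(x) p(u|x) be the joint
density, e_k the k-th component of the error and s_k = ∂_k log w, the derivative being in x. On Ω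
one has ∂_k(w e_k) = w (e_k s_k - 1). If this integrates to zero, then E[e_k s_k] = 1 for every k,
and Cauchy–Schwarz summed over k gives m² ≤ MSE · Σ_k E[s_k²] (`sq_le_mul_of_cross_moment`). The
Gaussian part of s_k is linear in the centred noise, so the cross term drops out and E[s_k²] =
(J_P)_kk + σ⁻² E Σ_j (∂_k g_j)². Bounding the trace of J_P by m λ₁ and each Jacobian entry by the
maximal one, the sum over k is at most m times the denominator of β
(`sum_lintegral_jointScore_sq_le`); one factor m cancels.

The delicate point is the vanishing integral, `setIntegral_lineDeriv_eq_zero`: partial derivatives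
merely exist, Ω is any open set, and boundary values are controlled only pointwise. The function f
is composed with a function that is zero near 0, which makes its extension by zero differentiable
along v everywhere. The cutoff is then removed, because f' = 0 almost everywhere on the zero set of
f. The two claims differ in where this is applied: to x ↦ w e_k with u fixed in (i), to x ↦ ∫ w e_k
du = p(x) B_k(x) in (ii). -/

noncomputable section

namespace SelectiveEncryption

/-! ### Integrals of directional derivatives over open sets. -/

/-- A continuous approximation of the indicator of `{y | y ≠ 0}` that vanishes near `0`. -/
def cutoff (ε y : ℝ) : ℝ := min 1 (max 0 (|y| / ε - 1))

lemma continuous_cutoff (ε : ℝ) : Continuous (cutoff ε) := by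
  unfold cutoff; fun_prop

lemma cutoff_nonneg (ε y : ℝ) : 0 ≤ cutoff ε y := le_min zero_le_one (le_max_left _ _)

lemma cutoff_le_one (ε y : ℝ) : cutoff ε y ≤ 1 := min_le_left _ _

lemma cutoff_eq_zero {ε y : ℝ} (hε : 0 < ε) (hy : |y| ≤ ε) : cutoff ε y = 0 := by
  have : |y| / ε - 1 ≤ 0 := by rw [sub_nonpos, div_le_one hε]; exact hy
  simp [cutoff, max_eq_left this]

lemma cutoff_eq_one {ε y : ℝ} (hε : 0 < ε) (hy : 2 * ε ≤ |y|) : cutoff ε y = 1 := by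
  have : 1 ≤ |y| / ε - 1 := by rw [le_sub_iff_add_le, le_div_iff₀ hε]; linarith
  exact min_eq_left (this.trans (le_max_right _ _))

/-- The primitive of `cutoff ε` that vanishes at `0`. -/
def cutoffPrimitive (ε y : ℝ) : ℝ := ∫ t in (0 : ℝ)..y, cutoff ε t

lemma hasDerivAt_cutoffPrimitive (ε y : ℝ) :
    HasDerivAt (cutoffPrimitive ε) (cutoff ε y) y :=
  intervalIntegral.integral_hasDerivAt_right ((continuous_cutoff ε).intervalIntegrable _ _)
    (continuous_cutoff ε).stronglyMeasurable.stronglyMeasurableAtFilter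
    (continuous_cutoff ε).continuousAt

lemma continuous_cutoffPrimitive (ε : ℝ) : Continuous (cutoffPrimitive ε) :=
  continuous_iff_continuousAt.2 fun y => (hasDerivAt_cutoffPrimitive ε y).continuousAt

lemma abs_cutoffPrimitive_le (ε y : ℝ) : |cutoffPrimitive ε y| ≤ |y| := by
  have := intervalIntegral.norm_integral_le_of_norm_le_const (a := 0) (b := y) (C := 1)
    (f := cutoff ε) fun t _ => by
      rw [Real.norm_eq_abs, abs_of_nonneg (cutoff_nonneg ε t)]; exact cutoff_le_one ε t
  simpa [cutoffPrimitive] using this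

lemma cutoffPrimitive_eq_zero {ε y : ℝ} (hε : 0 < ε) (hy : |y| ≤ ε) :
    cutoffPrimitive ε y = 0 := by
  have h : ∀ t ∈ Set.uIcc 0 y, cutoff ε t = 0 := fun t ht => by
    refine cutoff_eq_zero hε (le_trans ?_ hy)
    simpa using Set.abs_sub_left_of_mem_uIcc ht
  rw [cutoffPrimitive, intervalIntegral.integral_congr (g := fun _ => 0) h]
  simp

lemma hasLineDerivAt_comp {E : Type*} [AddCommGroup E] [Module ℝ E] {f : E → ℝ}
    {φ : ℝ → ℝ} {f' φ' : ℝ} {x v : E} (hφ : HasDerivAt φ φ' (f x))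
    (hf : HasLineDerivAt ℝ f f' x v) : HasLineDerivAt ℝ (fun y => φ (f y)) (φ' * f') x v := by
  unfold HasLineDerivAt at *
  refine HasDerivAt.comp (h₂ := φ) (0 : ℝ) ?_ hf
  simpa using hφ

/-- A zero with nonzero derivative is isolated among the zeros, and a discrete subspace of the line
is countable. -/
lemma countable_zeros_of_deriv_ne_zero (F F' : ℝ → ℝ) (U : Set ℝ)
    (hF : ∀ t ∈ U, HasDerivAt F (F' t) t) :
    {t | t ∈ U ∧ F t = 0 ∧ F' t ≠ 0}.Countable := by
  set Z := {t | t ∈ U ∧ F t = 0 ∧ F' t ≠ 0}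
  have hdisc : DiscreteTopology Z := by
    rw [discreteTopology_subtype_iff]
    rintro t ⟨htU, -, ht'⟩
    have h := (hF t htU).eventually_ne (c := 0) ht'
    rw [← disjoint_iff, disjoint_principal_right]
    filter_upwards [h] with s hs hsZ using hs hsZ.2.1
  exact Set.countable_coe_iff.1 (countable_of_Lindelof_of_discrete (X := Z))

section

variable {E : Type*} [NormedAddCommGroup E] [NormedSpace ℝ E] [MeasurableSpace E] [BorelSpace E]

/-- On Ω the derivative is the limit of the difference quotients with steps 1/(n+1), each of which
is measurable. -/
lemma measurable_indicator_lineDeriv {Ω : Set E} (hΩ : IsOpen Ω) {f f' : E → ℝ} {v : E}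
    (hf : Measurable f) (hd : ∀ x ∈ Ω, HasLineDerivAt ℝ f (f' x) x v) :
    Measurable (Ω.indicator f') := by
  have hlim : Tendsto (fun n : ℕ => (1 / ((n : ℝ) + 1))) atTop (𝓝[≠] 0) :=
    tendsto_nhdsWithin_iff.2 ⟨tendsto_one_div_add_atTop_nhds_zero_nat,
      Eventually.of_forall fun n => by simp only [Set.mem_compl_iff, Set.mem_singleton_iff]; positivity⟩
  refine measurable_of_tendsto_metrizable (f := fun (n : ℕ) => Ω.indicator
    (fun x => (1 / ((n : ℝ) + 1))⁻¹ • (f (x + (1 / ((n : ℝ) + 1)) • v) - f x))) ?_ ?_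
  · intro n
    refine Measurable.indicator ?_ hΩ.measurableSet
    exact ((hf.comp (continuous_add_const _).measurable).sub hf).const_mul _
  · rw [tendsto_pi_nhds]
    intro x
    by_cases hx : x ∈ Ω
    · simp only [Set.indicator_of_mem hx]
      exact (hasLineDerivAt_iff_tendsto_slope_zero.1 (hd x hx)).comp hlim
    · simp only [Set.indicator_of_notMem hx]
      exact tendsto_const_nhds

variable [FiniteDimensional ℝ E] {μ : Measure E} [μ.IsAddHaarMeasure]

lemma ae_lineDeriv_eq_zero_of_eq_zero {Ω : Set E} (hΩ : IsOpen Ω) {f f' : E → ℝ} {v : E}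
    (hf : Measurable f) (hd : ∀ x ∈ Ω, HasLineDerivAt ℝ f (f' x) x v) :
    ∀ᵐ x ∂μ, x ∈ Ω → f x = 0 → f' x = 0 := by
  have hmeas : MeasurableSet {x | f x = 0 → Ω.indicator f' x = 0} := by
    have h1 : MeasurableSet {x | f x = 0} := hf (measurableSet_singleton 0)
    have h2 : MeasurableSet {x | Ω.indicator f' x = 0} :=
      measurable_indicator_lineDeriv hΩ hf hd (measurableSet_singleton 0)
    exact h1.imp h2
  -- Fubini along lines parallel to v: it is enough that on each such line the bad parameters form a
  -- null set, and they are even countable.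
  have key := ae_mem_of_ae_add_linearMap_mem (LinearMap.toSpanSingleton ℝ E v) volume μ hmeas
    fun y => by
      have hc := countable_zeros_of_deriv_ne_zero (fun t => f (y + t • v))
        (fun t => f' (y + t • v)) {t | y + t • v ∈ Ω} fun t ht => by
          have h := hd _ ht
          unfold HasLineDerivAt at h
          -- The base point 0 is written as `t + -t` so that the translation by -t moves it to t.
          have h' : HasDerivAt (fun s => f (y + t • v + s • v)) (f' (y + t • v)) (t + -t) := by
            simpa using h
          have := h'.comp_add_const (x := t) (a := -t)
          refine this.congr_of_eventuallyEq (Eventually.of_forall fun s => ?_)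
          simp only
          congr 1
          rw [add_smul, neg_smul]; abel
      filter_upwards [hc.ae_notMem volume] with t ht
      simp only [LinearMap.toSpanSingleton_apply]
      intro h0
      by_cases hx : y + t • v ∈ Ω
      · rw [Set.indicator_of_mem hx]
        by_contra hne
        exact ht ⟨hx, h0, hne⟩
      · exact Set.indicator_of_notMem hx _
  filter_upwards [key] with x hx hxΩ h0
  simpa [Set.indicator_of_mem hxΩ] using hx h0

/-- The integral over an open set of a directional derivative of a function that vanishes at the
boundary is zero. -/
theorem setIntegral_lineDeriv_eq_zero {Ω : Set E} (hΩ : IsOpen Ω) {f f' : E → ℝ} {v : E}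
    (hf : Measurable f) (hzero : ∀ x, x ∉ Ω → f x = 0)
    (hd : ∀ x ∈ Ω, HasLineDerivAt ℝ f (f' x) x v)
    (hb : ∀ x₀ ∈ frontier Ω, Tendsto f (𝓝[Ω] x₀) (𝓝 0))
    (hint : Integrable f μ) (hint' : IntegrableOn f' Ω μ) :
    ∫ x in Ω, f' x ∂μ = 0 := by
  have hgm := measurable_indicator_lineDeriv hΩ hf hd
  rw [← integral_indicator hΩ.measurableSet]
  rw [← integrable_indicator_iff hΩ.measurableSet] at hint'
  set g := Ω.indicator f' with hg
  -- The extension of f by zero is continuous at each point outside Ω: by `hb` on the frontier, and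
  -- because f vanishes nearby off the closure.
  have hsmall : ∀ x, x ∉ Ω → ∀ ε > 0, ∀ᶠ y in 𝓝 x, |f y| ≤ ε := by
    intro x hx ε hε
    by_cases hxc : x ∈ closure Ω
    · have hfr : x ∈ frontier Ω := ⟨hxc, by rwa [hΩ.interior_eq]⟩
      have h1 : ∀ᶠ y in 𝓝[Ω] x, |f y| ≤ ε := by
        have := (hb x hfr).eventually (Metric.ball_mem_nhds (0 : ℝ) hε)
        filter_upwards [this] with y hy
        have : |f y| < ε := by simpa using hy
        exact this.le
      filter_upwards [eventually_nhdsWithin_iff.1 h1] with y hy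
      by_cases hyΩ : y ∈ Ω
      · exact hy hyΩ
      · simp [hzero y hyΩ, hε.le]
    · filter_upwards [isClosed_closure.isOpen_compl.mem_nhds hxc] with y hy
      have hyΩ : y ∉ Ω := fun h => hy (subset_closure h)
      simp [hzero y hyΩ, hε.le]
  have hstep : ∀ ε > 0, ∫ x, cutoff ε (f x) * g x ∂μ = 0 := by
    intro ε hε
    have hD : ∀ x, HasLineDerivAt ℝ (fun y => cutoffPrimitive ε (f y))
        (cutoff ε (f x) * g x) x v := by
      intro x
      by_cases hx : x ∈ Ω
      · rw [hg, Set.indicator_of_mem hx]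
        exact hasLineDerivAt_comp (hasDerivAt_cutoffPrimitive ε _) (hd x hx)
      · rw [hg, Set.indicator_of_notMem hx, mul_zero]
        -- Near a point outside Ω, |f| ≤ ε, where the primitive is identically zero; this supplies
        -- the derivative that f itself may lack there.
        have hz : (fun y => cutoffPrimitive ε (f y)) =ᶠ[𝓝 x] 0 := by
          filter_upwards [hsmall x hx ε hε] with y hy
          exact cutoffPrimitive_eq_zero hε hy
        have h0 : HasLineDerivAt ℝ (0 : E → ℝ) 0 x v := hasDerivAt_const (0 : ℝ) (0 : ℝ)
        exact h0.congr_of_eventuallyEq hz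
    have hI1 : Integrable (fun x => cutoff ε (f x) * g x) μ := by
      refine hint'.mono ((((continuous_cutoff ε).measurable.comp hf).mul hgm).aestronglyMeasurable)
        (Eventually.of_forall fun x => ?_)
      rw [norm_mul, Real.norm_eq_abs, abs_of_nonneg (cutoff_nonneg _ _)]
      exact mul_le_of_le_one_left (norm_nonneg _) (cutoff_le_one _ _)
    have hI2 : Integrable (fun x => cutoffPrimitive ε (f x)) μ :=
      hint.mono (((continuous_cutoffPrimitive ε).measurable.comp hf).aestronglyMeasurable)
        (Eventually.of_forall fun x => abs_cutoffPrimitive_le ε (f x))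
    -- Integration by parts against the constant 1; integrability of the function and of its
    -- derivative takes the place of decay at infinity.
    have := integral_bilinear_hasLineDerivAt_right_eq_neg_left_of_integrable (μ := μ)
      (f := fun x => cutoffPrimitive ε (f x)) (f' := fun x => cutoff ε (f x) * g x)
      (g := fun _ => (1 : ℝ)) (g' := fun _ => (0 : ℝ)) (v := v) (B := ContinuousLinearMap.mul ℝ ℝ)
      (by simpa using hI1) (by simp) (by simpa using hI2) (fun x _ => hD x)
      (fun x _ => by
        have : HasDerivAt (fun _ : ℝ => (1 : ℝ)) 0 0 := hasDerivAt_const _ _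
        exact this)
    simpa using this.symm
  have hlim : Tendsto (fun n : ℕ => ∫ x, cutoff (1 / ((n : ℝ) + 1)) (f x) * g x ∂μ) atTop
      (𝓝 (∫ x, g x ∂μ)) := by
    refine tendsto_integral_of_dominated_convergence (fun x => ‖g x‖) (fun n =>
      (((continuous_cutoff _).measurable.comp hf).mul hgm).aestronglyMeasurable) hint'.norm
      (fun n => Eventually.of_forall fun x => ?_) ?_
    · rw [norm_mul, Real.norm_eq_abs, abs_of_nonneg (cutoff_nonneg _ _)]
      exact mul_le_of_le_one_left (norm_nonneg _) (cutoff_le_one _ _)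
    -- Where f ≠ 0 the cutoff factor is eventually 1. Where f = 0 it is always 0, which is the right
    -- limit because f' = 0 there almost everywhere.
    · filter_upwards [ae_lineDeriv_eq_zero_of_eq_zero (μ := μ) hΩ hf hd] with x hx
      by_cases hxΩ : x ∈ Ω
      · by_cases h0 : f x = 0
        · have : g x = 0 := by rw [hg, Set.indicator_of_mem hxΩ, hx hxΩ h0]
          simp [this]
        · refine tendsto_const_nhds.congr' ?_
          have h2 : 0 < |f x| / 2 := by positivity
          filter_upwards [(tendsto_one_div_add_atTop_nhds_zero_nat (𝕜 := ℝ)).eventually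
            (gt_mem_nhds h2)] with n hn
          rw [cutoff_eq_one (by positivity) (by linarith), one_mul]
      · have : g x = 0 := Set.indicator_of_notMem hxΩ _
        simp [this]
  refine tendsto_nhds_unique hlim ?_
  refine tendsto_const_nhds.congr fun n => (hstep _ (by positivity)).symm

end

/-! ### Gaussian noise: density and second moments. -/

section Gaussian

variable {D : ℕ} (S : Finset (Fin D))

lemma card_unencrypted : Fintype.card {j : Fin D // j ∉ S} = D - S.card := by
  rw [Fintype.card_subtype_compl]; simp

lemma posSemidef_noise_covariance (σ : ℝ) :
    ((σ ^ 2) • (1 : Matrix {j : Fin D // j ∉ S} {j : Fin D // j ∉ S} ℝ)).PosSemidef :=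
  Matrix.PosSemidef.one.smul (sq_nonneg σ)

lemma measurable_prolongOp : Measurable (prolongOp S) := by
  refine (WithLp.measurable_toLp 2 _).comp (measurable_pi_iff.2 fun j => ?_)
  by_cases h : j ∉ S
  · simp only [h, not_false_eq_true, dite_true]; fun_prop
  · simp only [h, dite_false]; fun_prop

lemma measurable_restrictOp : Measurable (restrictOp S) :=
  (WithLp.measurable_toLp 2 _).comp (measurable_pi_iff.2 fun j => by fun_prop)

lemma measurable_likelihood (σ : ℝ) {α : Type*} [MeasurableSpace α] {v : α → Eu D}
    {u : α → Unenc S} (hv : Measurable v) (hu : Measurable u) :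
    Measurable fun a => likelihood S σ (v a) (u a) := by
  have := measurable_restrictOp S
  unfold likelihood
  fun_prop

lemma measurable_likelihood_right (σ : ℝ) (v : Eu D) : Measurable (likelihood S σ v) := by
  unfold likelihood
  fun_prop

lemma likelihood_pos {σ : ℝ} (hσ : 0 < σ) (v : Eu D) (u : Unenc S) :
    0 < likelihood S σ v u := by
  unfold likelihood
  have : 0 < 2 * Real.pi * σ ^ 2 := by positivity
  positivity

lemma likelihood_le {σ : ℝ} (hσ : 0 < σ) (v : Eu D) (u : Unenc S) :
    likelihood S σ v u ≤ (Real.sqrt (2 * Real.pi * σ ^ 2) ^ (D - S.card))⁻¹ := by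
  unfold likelihood
  refine mul_le_of_le_one_right (by positivity) (Real.exp_le_one_iff.2 ?_)
  rw [neg_div]
  have : 0 ≤ ‖u - restrictOp S v‖ ^ 2 / (2 * σ ^ 2) := by positivity
  linarith

lemma likelihood_eq_zero_sub (σ : ℝ) (v : Eu D) (u : Unenc S) :
    likelihood S σ v u = likelihood S σ 0 (u - restrictOp S v) := by
  have : restrictOp S (0 : Eu D) = 0 := by ext j; simp [restrictOp]
  simp [likelihood, this]

lemma likelihood_zero (σ : ℝ) (u : Unenc S) :
    likelihood S σ 0 u = (Real.sqrt (2 * Real.pi * σ ^ 2) ^ (D - S.card))⁻¹ *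
      Real.exp (-(1 / (2 * σ ^ 2)) * ‖u‖ ^ 2) := by
  have : restrictOp S (0 : Eu D) = 0 := by ext j; simp [restrictOp]
  simp only [likelihood, this, sub_zero]
  congr 2; ring

lemma integrable_likelihood_zero {σ : ℝ} (hσ : 0 < σ) :
    Integrable (likelihood S σ 0) := by
  have hb : 0 < ((1 / (2 * σ ^ 2) : ℝ) : ℂ).re := by rw [Complex.ofReal_re]; positivity
  have h := GaussianFourier.integrable_cexp_neg_mul_sq_norm_add hb 0 (0 : Unenc S)
  have h2 := h.norm.const_mul (Real.sqrt (2 * Real.pi * σ ^ 2) ^ (D - S.card))⁻¹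
  refine h2.congr (Eventually.of_forall fun u => ?_)
  simp only [likelihood_zero, Complex.norm_exp]
  congr 2
  simp [← Complex.ofReal_pow, ← Complex.ofReal_neg, ← Complex.ofReal_mul]

/-- The isotropic Gaussian law has the expected Lebesgue density. -/
theorem noise_eq_withDensity {σ : ℝ} (hσ : 0 < σ) :
    noise S σ = volume.withDensity fun u => ENNReal.ofReal (likelihood S σ 0 u) := by
  have hfin : IsFiniteMeasure
      (volume.withDensity fun u : Unenc S => ENNReal.ofReal (likelihood S σ 0 u)) :=
    isFiniteMeasure_withDensity_ofReal (integrable_likelihood_zero S hσ).2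
  have hm := measurable_likelihood_right S σ 0
  have : IsGaussian (noise S σ) := by unfold noise; infer_instance
  -- Finite measures are determined by their characteristic functions; that of the density is the
  -- Gaussian Fourier integral with b = 1/(2σ²).
  refine Measure.ext_of_charFun (funext fun t => ?_)
  rw [noise, charFun_multivariateGaussian (posSemidef_noise_covariance S σ), charFun_apply]
  rw [integral_withDensity_eq_integral_toReal_smul hm.ennreal_ofReal
    (Eventually.of_forall fun _ => ENNReal.ofReal_lt_top)]
  have hb : 0 < ((1 / (2 * σ ^ 2) : ℝ) : ℂ).re := by rw [Complex.ofReal_re]; positivity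
  have hF := GaussianFourier.integral_cexp_neg_mul_sq_norm_add hb Complex.I t
  have hpt : ∀ u : Unenc S, (ENNReal.ofReal (likelihood S σ 0 u)).toReal •
      Complex.exp ((inner ℝ u t : ℝ) * Complex.I) =
      ((Real.sqrt (2 * Real.pi * σ ^ 2) ^ (D - S.card))⁻¹ : ℝ) *
        Complex.exp (-((1 / (2 * σ ^ 2) : ℝ) : ℂ) * ‖u‖ ^ 2 + Complex.I * (inner ℝ t u : ℝ)) := by
    intro u
    rw [ENNReal.toReal_ofReal (likelihood_pos S hσ 0 u).le, likelihood_zero, Complex.real_smul,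
      Complex.exp_add, real_inner_comm u t]
    push_cast
    ring_nf
  simp_rw [hpt]
  rw [integral_const_mul, hF]
  have hd : (Module.finrank ℝ (Unenc S) / 2 : ℂ) = ((D - S.card : ℕ) : ℂ) / 2 := by
    rw [finrank_euclideanSpace, card_unencrypted]
  -- The factor (π/b)^(d/2) of the Fourier integral equals √(2πσ²)^d and cancels the normalising
  -- constant of the likelihood.
  have h2 : (((Real.pi : ℂ) / ((1 / (2 * σ ^ 2) : ℝ) : ℂ)) ^ (Module.finrank ℝ (Unenc S) / 2 : ℂ))
      = ((Real.sqrt (2 * Real.pi * σ ^ 2) ^ (D - S.card) : ℝ) : ℂ) := by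
    have hpos : (0 : ℝ) ≤ 2 * Real.pi * σ ^ 2 := by positivity
    have e : ((Real.pi : ℂ) / ((1 / (2 * σ ^ 2) : ℝ) : ℂ)) = ((2 * Real.pi * σ ^ 2 : ℝ) : ℂ) := by
      push_cast; field_simp
    have e2 : (((D - S.card : ℕ) : ℂ) / 2) = (((D - S.card : ℕ) : ℝ) / 2 : ℝ) := by push_cast; rfl
    rw [hd, e, e2, ← Complex.ofReal_cpow hpos, Real.sqrt_eq_rpow,
      ← Real.rpow_mul_natCast hpos]
    congr 2; ring
  rw [h2, ← mul_assoc, ← Complex.ofReal_mul, inv_mul_cancel₀ (by positivity), Complex.ofReal_one,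
    one_mul]
  congr 1
  have hdot : t.ofLp ⬝ᵥ ((σ ^ 2) • (1 : Matrix {j : Fin D // j ∉ S} {j : Fin D // j ∉ S} ℝ)).mulVec
      t.ofLp = σ ^ 2 * ‖t‖ ^ 2 := by
    rw [EuclideanSpace.real_norm_sq_eq, Matrix.smul_mulVec, Matrix.one_mulVec, dotProduct_smul,
      dotProduct, smul_eq_mul]
    simp [pow_two]
  rw [inner_zero_right]
  rw [hdot]
  rw [Complex.I_sq]
  push_cast
  field_simp
  ring

/-- The expectation over the noise in terms of the likelihood. -/
lemma lintegral_noise {σ : ℝ} (hσ : 0 < σ) (v : Eu D) {h : Unenc S → ℝ≥0∞} (hh : Measurable h) :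
    ∫⁻ δ, h (restrictOp S v + δ) ∂(noise S σ) =
      ∫⁻ u, ENNReal.ofReal (likelihood S σ v u) * h u := by
  have hm := measurable_likelihood_right S σ 0
  have hh' : Measurable fun δ => h (restrictOp S v + δ) := hh.comp (measurable_const_add _)
  rw [noise_eq_withDensity S hσ, lintegral_withDensity_eq_lintegral_mul _ hm.ennreal_ofReal hh']
  rw [← lintegral_sub_right_eq_self _ (restrictOp S v)]
  refine lintegral_congr fun u => ?_
  simp [likelihood_eq_zero_sub S σ v u]

/-- The noise has mean zero, which kills the term linear in δ, and its covariance σ²I gives the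
quadratic one. Applied to the joint score at fixed x, this separates the prior information from that
of the observation. -/
lemma lintegral_noise_affine_sq (σ : ℝ) (c : ℝ) (a : {j : Fin D // j ∉ S} → ℝ) :
    ∫⁻ δ : Unenc S, ENNReal.ofReal ((c + ∑ j, δ j * a j) ^ 2) ∂(noise S σ) =
      ENNReal.ofReal (c ^ 2 + σ ^ 2 * ∑ j, a j ^ 2) := by
  have hG : IsGaussian (noise S σ) := by unfold noise; infer_instance
  set b : Unenc S := WithLp.toLp 2 a
  have hinner : ∀ δ : Unenc S, ∑ j, δ j * a j = inner ℝ b δ := fun δ => by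
    simp [PiLp.inner_apply, b]
  have hL2 : MemLp (fun δ : Unenc S => inner ℝ b δ) 2 (noise S σ) :=
    (IsGaussian.memLp_two_id (μ := noise S σ)).const_inner b
  have hmean : ∫ δ, inner ℝ b δ ∂(noise S σ) = 0 := by
    rw [integral_inner IsGaussian.integrable_fun_id]
    unfold noise
    rw [integral_id_multivariateGaussian, inner_zero_right]
  have hvar : ∫ δ, (inner ℝ b δ) ^ 2 ∂(noise S σ) = σ ^ 2 * ∑ j, a j ^ 2 := by
    have h1 := covarianceBilin_multivariateGaussian (μ := 0) (posSemidef_noise_covariance S σ) b b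
    have h2 := covarianceBilin_self (μ := noise S σ) IsGaussian.memLp_two_id b
    rw [variance_of_integral_eq_zero (hL2.aestronglyMeasurable.aemeasurable) hmean] at h2
    rw [← h2]
    unfold noise
    rw [h1, Matrix.smul_mulVec, Matrix.one_mulVec, dotProduct_smul, dotProduct, smul_eq_mul]
    simp [pow_two, b]
  have hI1 := hL2.integrable one_le_two
  have hI2 := hL2.integrable_sq
  simp_rw [hinner]
  have hexp : ∀ δ : Unenc S, (c + inner ℝ b δ) ^ 2 =
      c ^ 2 + 2 * c * inner ℝ b δ + (inner ℝ b δ) ^ 2 := fun δ => by ring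
  simp_rw [hexp]
  have hI : Integrable (fun δ : Unenc S => c ^ 2 + 2 * c * inner ℝ b δ + (inner ℝ b δ) ^ 2)
      (noise S σ) := ((integrable_const _).add (hI1.const_mul _)).add hI2
  rw [← ofReal_integral_eq_lintegral_ofReal hI
    (Eventually.of_forall fun δ => by simp only [Pi.zero_apply, ← hexp]; positivity)]
  congr 1
  have hI0 : Integrable (fun δ : Unenc S => c ^ 2 + 2 * c * inner ℝ b δ) (noise S σ) :=
    (integrable_const _).add (hI1.const_mul _)
  rw [integral_add hI0 hI2, integral_add (integrable_const _) (hI1.const_mul _), integral_const_mul, hmean, hvar]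
  simp

end Gaussian

/-! ### The joint density, its score and its Fisher information. -/

section Joint

variable {m D : ℕ} (Ω : Set (Eu m)) (p : Eu m → ℝ) (g : Eu m → Eu D) (S : Finset (Fin D)) (σ : ℝ)

/-- The joint Lebesgue density of the data point and the unencrypted noisy gradient. -/
def jointDensity (q : Eu m × Unenc S) : ℝ := p q.1 * likelihood S σ (g q.1) q.2

/-- The `k`-th component of the estimation error. -/
def estimationError (A : Eu D → Eu m) (k : Fin m) (q : Eu m × Unenc S) : ℝ :=
  (A (prolongOp S q.2) - q.1) k

/-- The prior score, set to zero outside `Ω`. -/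
def priorScore (i : Fin m) : Eu m → ℝ := Ω.indicator fun x => partialDeriv i p x / p x

/-- An entry of the restricted Jacobian, set to zero outside `Ω`. -/
def jacobianEntry (i : Fin m) (j : {j : Fin D // j ∉ S}) : Eu m → ℝ :=
  Ω.indicator fun x => partialDeriv i (fun x' => g x' j.1) x

/-- The `i`-th component of the score of the joint density. -/
def jointScore (i : Fin m) (q : Eu m × Unenc S) : ℝ :=
  priorScore Ω p i q.1 + ∑ j, (q.2 j - g q.1 j.1) * (jacobianEntry Ω g S i j q.1 / σ ^ 2)

variable {Ω p g S σ}

lemma HasPartial.hasLineDerivAt {i : Fin m} {f : Eu m → ℝ} {x : Eu m} (h : HasPartial i f x) :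
    HasLineDerivAt ℝ f (partialDeriv i f x) x (EuclideanSpace.single i 1) :=
  LineDifferentiableAt.hasLineDerivAt h

lemma measurable_jointDensity (hp : Measurable p) (hg : Measurable g) :
    Measurable (jointDensity p g S σ) :=
  (hp.comp measurable_fst).mul
    (measurable_likelihood S σ (hg.comp measurable_fst) measurable_snd)

lemma measurable_estimationError {A : Eu D → Eu m} (hA : Measurable A) (k : Fin m) :
    Measurable (estimationError S A k) := by
  have h : Measurable fun q : Eu m × Unenc S => A (prolongOp S q.2) - q.1 :=
    (hA.comp ((measurable_prolongOp S).comp measurable_snd)).sub measurable_fst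
  exact (EuclideanSpace.proj (𝕜 := ℝ) k).continuous.measurable.comp h

lemma measurable_priorScore (hΩ : IsOpen Ω) (hp : Measurable p)
    {i : Fin m} (hd : ∀ x ∈ Ω, HasPartial i p x) : Measurable (priorScore Ω p i) := by
  have h := (measurable_indicator_lineDeriv hΩ hp fun x hx => (hd x hx).hasLineDerivAt).div hp
  convert h using 1
  ext x
  by_cases hx : x ∈ Ω <;> simp [priorScore, hx]

lemma measurable_jacobianEntry (hΩ : IsOpen Ω) (hg : Measurable g) {i : Fin m}
    {j : {j : Fin D // j ∉ S}} (hd : ∀ x ∈ Ω, HasPartial i (fun x' => g x' j.1) x) :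
    Measurable (jacobianEntry Ω g S i j) :=
  measurable_indicator_lineDeriv hΩ
    ((EuclideanSpace.proj (𝕜 := ℝ) j.1).continuous.measurable.comp hg)
    fun x hx => (hd x hx).hasLineDerivAt

lemma measurable_jointScore (hΩ : IsOpen Ω) (hp : Measurable p) (hg : Measurable g) {i : Fin m}
    (hpd : ∀ x ∈ Ω, HasPartial i p x)
    (hgd : ∀ x ∈ Ω, ∀ j : Fin D, j ∉ S → HasPartial i (fun x' => g x' j) x) :
    Measurable (jointScore Ω p g S σ i) := by
  unfold jointScore
  refine ((measurable_priorScore hΩ hp hpd).comp measurable_fst).add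
    (Finset.measurable_sum _ fun j _ => ?_)
  have h1 : Measurable fun q : Eu m × Unenc S => q.2 j :=
    (EuclideanSpace.proj (𝕜 := ℝ) j).continuous.measurable.comp measurable_snd
  have h2 : Measurable fun q : Eu m × Unenc S => g q.1 j.1 :=
    (EuclideanSpace.proj (𝕜 := ℝ) j.1).continuous.measurable.comp (hg.comp measurable_fst)
  have h3 := measurable_jacobianEntry (j := j) hΩ hg fun x hx => hgd x hx j.1 j.2
  exact (h1.sub h2).mul ((h3.comp measurable_fst).div_const _)

/-- Expectations under the joint law as Lebesgue integrals. -/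
lemma lintegral_jointDensity_mul (hσ : 0 < σ) (hp : Measurable p) (hp0 : ∀ x, 0 ≤ p x)
    (hg : Measurable g) {h : Eu m × Unenc S → ℝ≥0∞} (hh : Measurable h) :
    ∫⁻ q, ENNReal.ofReal (jointDensity p g S σ q) * h q ∂(volume.prod volume) =
      ∫⁻ x, ∫⁻ δ, h (x, restrictOp S (g x) + δ) ∂(noise S σ) ∂(dataLaw p) := by
  have hinner : ∀ x, ∫⁻ δ, h (x, restrictOp S (g x) + δ) ∂(noise S σ) =
      ∫⁻ u, ENNReal.ofReal (likelihood S σ (g x) u) * h (x, u) := fun x =>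
    lintegral_noise S hσ (g x) (h := fun u => h (x, u)) (hh.comp measurable_prodMk_left)
  simp_rw [hinner]
  have hmeas : Measurable fun q : Eu m × Unenc S =>
      ENNReal.ofReal (likelihood S σ (g q.1) q.2) * h q :=
    (measurable_likelihood S σ (hg.comp measurable_fst) measurable_snd).ennreal_ofReal.mul hh
  have hjoint : Measurable fun q : Eu m × Unenc S =>
      ENNReal.ofReal (jointDensity p g S σ q) * h q :=
    (measurable_jointDensity hp hg).ennreal_ofReal.mul hh
  rw [dataLaw, lintegral_withDensity_eq_lintegral_mul _ hp.ennreal_ofReal hmeas.lintegral_prod_right',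
    lintegral_prod _ hjoint.aemeasurable]
  refine lintegral_congr fun x => ?_
  rw [Pi.mul_apply, ← lintegral_const_mul' _ _ ENNReal.ofReal_ne_top]
  refine lintegral_congr fun u => ?_
  simp only [jointDensity]
  rw [ENNReal.ofReal_mul (hp0 x), mul_assoc]

lemma meanSquaredError_eq_lintegral (hσ : 0 < σ) (hp : Measurable p) (hp0 : ∀ x, 0 ≤ p x)
    (hg : Measurable g) {A : Eu D → Eu m} (hA : Measurable A) :
    meanSquaredError p g S σ A = ∫⁻ q, ENNReal.ofReal (jointDensity p g S σ q) *
      ENNReal.ofReal (∑ k, estimationError S A k q ^ 2) ∂(volume.prod volume) := by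
  have hm : Measurable fun q : Eu m × Unenc S =>
      ENNReal.ofReal (∑ k, estimationError S A k q ^ 2) :=
    (Finset.measurable_sum _ fun k _ => (measurable_estimationError hA k).pow_const 2).ennreal_ofReal
  rw [lintegral_jointDensity_mul hσ hp hp0 hg hm]
  refine lintegral_congr fun x => ?_
  have h1 : Measurable fun y => ENNReal.ofReal (‖A y - x‖ ^ 2) := by fun_prop
  have h2 : Measurable fun δ => prolongOp S (restrictOp S (g x) + δ) :=
    (measurable_prolongOp S).comp (measurable_const_add _)
  rw [observation, lintegral_map h1 h2]
  refine lintegral_congr fun δ => ?_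
  rw [EuclideanSpace.real_norm_sq_eq]
  rfl

lemma lintegral_jointDensity (hσ : 0 < σ) (hp : Measurable p) (hp0 : ∀ x, 0 ≤ p x)
    (hg : Measurable g) (hprob : IsProbabilityMeasure (dataLaw p)) :
    ∫⁻ q, ENNReal.ofReal (jointDensity p g S σ q) ∂(volume.prod volume) = 1 := by
  have h := lintegral_jointDensity_mul (S := S) hσ hp hp0 hg (h := fun _ => 1) measurable_const
  have : IsGaussian (noise S σ) := by unfold noise; infer_instance
  simpa using h

/-- At fixed x, substituting u = R g(x) + δ makes the joint score affine in δ, so its second moment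
is that of `lintegral_noise_affine_sq`; the weights 1/σ² squared, times the variance σ², leave 1/σ².
-/
lemma lintegral_jointScore_sq (hσ : 0 < σ) (hΩ : IsOpen Ω) (hp : Measurable p)
    (hp0 : ∀ x, 0 ≤ p x) (hg : Measurable g) {i : Fin m}
    (hpd : ∀ x ∈ Ω, HasPartial i p x)
    (hgd : ∀ x ∈ Ω, ∀ j : Fin D, j ∉ S → HasPartial i (fun x' => g x' j) x) :
    ∫⁻ q, ENNReal.ofReal (jointDensity p g S σ q) *
        ENNReal.ofReal (jointScore Ω p g S σ i q ^ 2) ∂(volume.prod volume) =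
      ∫⁻ x, ENNReal.ofReal (priorScore Ω p i x ^ 2 +
        (∑ j, jacobianEntry Ω g S i j x ^ 2) / σ ^ 2) ∂(dataLaw p) := by
  rw [lintegral_jointDensity_mul hσ hp hp0 hg
    ((measurable_jointScore hΩ hp hg hpd hgd).pow_const 2).ennreal_ofReal]
  refine lintegral_congr fun x => ?_
  have h := lintegral_noise_affine_sq S σ (priorScore Ω p i x)
    fun j => jacobianEntry Ω g S i j x / σ ^ 2
  have e : ∀ δ : Unenc S, jointScore Ω p g S σ i (x, restrictOp S (g x) + δ) =
      priorScore Ω p i x + ∑ j, δ j * (jacobianEntry Ω g S i j x / σ ^ 2) := fun δ => by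
    simp [jointScore, restrictOp]
  simp_rw [e]
  rw [h]
  congr 2
  rw [Finset.mul_sum, Finset.sum_div]
  refine Finset.sum_congr rfl fun j _ => ?_
  field_simp

lemma sq_le_maxNormSq {ι κ : Type} [Finite ι] [Finite κ] (M : Matrix ι κ ℝ) (j : ι) (i : κ) :
    M j i ^ 2 ≤ maxNormSq M := by
  rw [maxNormSq, ← sq_abs]
  exact pow_le_pow_left₀ (abs_nonneg _)
    (le_ciSup (f := fun q : ι × κ => |M q.1 q.2|) (Set.finite_range _).bddAbove (j, i)) 2

lemma sum_jacobianEntry_sq_le (i : Fin m) (x : Eu m) :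
    ∑ j, jacobianEntry Ω g S i j x ^ 2 ≤
      (D - S.card : ℕ) * maxNormSq (restrictedJacobian g S x) := by
  have h : ∀ j, jacobianEntry Ω g S i j x ^ 2 ≤ maxNormSq (restrictedJacobian g S x) := fun j => by
    by_cases hx : x ∈ Ω
    · rw [jacobianEntry, Set.indicator_of_mem hx]
      exact sq_le_maxNormSq (restrictedJacobian g S x) j i
    · rw [jacobianEntry, Set.indicator_of_notMem hx, zero_pow two_ne_zero]
      exact sq_nonneg _
  refine (Finset.sum_le_card_nsmul _ _ _ fun j _ => h j).trans ?_
  rw [Finset.card_univ, card_unencrypted, nsmul_eq_mul]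

lemma mul_one_sub_encryptionRatio (S : Finset (Fin D)) :
    (D : ℝ) * (1 - encryptionRatio S) = (D - S.card : ℕ) := by
  have hle : S.card ≤ D := by simpa using Finset.card_le_univ S
  rw [Nat.cast_sub hle, encryptionRatio]
  -- For D = 0 the ratio is 0/0 = 0 by convention, and both sides vanish.
  rcases Nat.eq_zero_or_pos D with h | h
  · subst h
    have : S.card = 0 := by omega
    simp [this]
  · field_simp

/-- The chain rule for log, valid where p > 0. The values outside Ω do not matter, since the data
law does not charge them. -/
lemma score_eq (hp_pos : ∀ x ∈ Ω, 0 < p x) {i : Fin m} (hpd : ∀ x ∈ Ω, HasPartial i p x)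
    {x : Eu m} (hx : x ∈ Ω) : score p i x = priorScore Ω p i x := by
  have h := hasLineDerivAt_comp (Real.hasDerivAt_log (hp_pos x hx).ne') (hpd x hx).hasLineDerivAt
  rw [priorScore, Set.indicator_of_mem hx, score, partialDeriv, h.lineDeriv]
  field_simp

lemma ae_mem_dataLaw (hp : Measurable p) (hp_zero : ∀ x, x ∉ Ω → p x = 0) :
    ∀ᵐ x ∂(dataLaw p), x ∈ Ω := by
  rw [dataLaw, ae_withDensity_iff hp.ennreal_ofReal]
  refine Eventually.of_forall fun x hx => ?_
  by_contra hxΩ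
  exact hx (by simp [hp_zero x hxΩ])

lemma lintegral_priorScore_sq (hp : Measurable p) (hp_pos : ∀ x ∈ Ω, 0 < p x)
    (hp_zero : ∀ x, x ∉ Ω → p x = 0) {i : Fin m} (hpd : ∀ x ∈ Ω, HasPartial i p x)
    (hJ : Integrable (fun x => score p i x ^ 2) (dataLaw p)) :
    ∫⁻ x, ENNReal.ofReal (priorScore Ω p i x ^ 2) ∂(dataLaw p) =
      ENNReal.ofReal (priorFisher p i i) := by
  have h : ∫⁻ x, ENNReal.ofReal (priorScore Ω p i x ^ 2) ∂(dataLaw p) =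
      ∫⁻ x, ENNReal.ofReal (score p i x ^ 2) ∂(dataLaw p) := by
    refine lintegral_congr_ae ?_
    filter_upwards [ae_mem_dataLaw hp hp_zero] with x hx
    rw [score_eq hp_pos hpd hx]
  rw [h, ← ofReal_integral_eq_lintegral_ofReal hJ (Eventually.of_forall fun x => sq_nonneg _)]
  simp [priorFisher, pow_two]

/-- The trace is the sum of the m eigenvalues, none of which exceeds the supremum of the spectrum.
-/
lemma trace_le_mul_lambdaMax {J : Matrix (Fin m) (Fin m) ℝ} (hJ : J.IsHermitian) :
    J.trace ≤ m * lambdaMax J := by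
  rw [hJ.trace_eq_sum_eigenvalues, lambdaMax, hJ.spectrum_real_eq_range_eigenvalues]
  refine (Finset.sum_le_card_nsmul _ _ (sSup (Set.range hJ.eigenvalues)) fun i _ => ?_).trans ?_
  · exact le_csSup (Set.finite_range _).bddAbove ⟨i, rfl⟩
  · simp

lemma isHermitian_priorFisher (p : Eu m → ℝ) : (priorFisher p).IsHermitian := by
  ext i k
  simp [priorFisher, mul_comm]

/-- The total Fisher information is at most `m` times the denominator of the privacy bound. -/
theorem sum_lintegral_jointScore_sq_le (hσ : 0 < σ) (hΩ : IsOpen Ω) (hp : Measurable p)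
    (hp_pos : ∀ x ∈ Ω, 0 < p x) (hp_zero : ∀ x, x ∉ Ω → p x = 0)
    (hg : Measurable g) (hpd : ∀ x ∈ Ω, ∀ i, HasPartial i p x)
    (hgd : ∀ x ∈ Ω, ∀ i, ∀ j : Fin D, j ∉ S → HasPartial i (fun x' => g x' j) x)
    (hJ : ∀ i, Integrable (fun x => score p i x ^ 2) (dataLaw p)) :
    ∑ i, ∫⁻ q, ENNReal.ofReal (jointDensity p g S σ q) *
        ENNReal.ofReal (jointScore Ω p g S σ i q ^ 2) ∂(volume.prod volume) ≤
      m * (ENNReal.ofReal ((D : ℝ) * (1 - encryptionRatio S) / σ ^ 2) *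
        (∫⁻ x, ENNReal.ofReal (maxNormSq (restrictedJacobian g S x)) ∂(dataLaw p)) +
      ENNReal.ofReal (lambdaMax (priorFisher p))) := by
  have hp0 : ∀ x, 0 ≤ p x := fun x => by
    by_cases hx : x ∈ Ω
    · exact (hp_pos x hx).le
    · exact (hp_zero x hx).ge
  set I := ∫⁻ x, ENNReal.ofReal (maxNormSq (restrictedJacobian g S x)) ∂(dataLaw p)
  have hterm : ∀ i, ∫⁻ q, ENNReal.ofReal (jointDensity p g S σ q) *
        ENNReal.ofReal (jointScore Ω p g S σ i q ^ 2) ∂(volume.prod volume) ≤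
      ENNReal.ofReal (priorFisher p i i) +
        ENNReal.ofReal ((D : ℝ) * (1 - encryptionRatio S) / σ ^ 2) * I := fun i => by
    rw [lintegral_jointScore_sq hσ hΩ hp hp0 hg (fun x hx => hpd x hx i) fun x hx => hgd x hx i,
      ← lintegral_priorScore_sq hp hp_pos hp_zero (fun x hx => hpd x hx i) (hJ i),
      ← lintegral_const_mul' _ _ ENNReal.ofReal_ne_top, ← lintegral_add_left
        ((measurable_priorScore hΩ hp fun x hx => hpd x hx i).pow_const 2).ennreal_ofReal]
    refine lintegral_mono fun x => ?_
    rw [mul_one_sub_encryptionRatio, ENNReal.ofReal_add (by positivity) (by positivity),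
      ← ENNReal.ofReal_mul (by positivity)]
    gcongr
    rw [div_mul_eq_mul_div]
    gcongr
    exact sum_jacobianEntry_sq_le i x
  have hdiag : ∀ i ∈ Finset.univ, 0 ≤ priorFisher p i i := fun i _ => by
    simp only [priorFisher, Matrix.of_apply]
    exact integral_nonneg fun x => mul_self_nonneg _
  refine (Finset.sum_le_sum fun i _ => hterm i).trans ?_
  rw [Finset.sum_add_distrib, ← ENNReal.ofReal_sum_of_nonneg hdiag, Finset.sum_const,
    Finset.card_univ, Fintype.card_fin, nsmul_eq_mul, mul_add, add_comm]
  gcongr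
  rw [← ENNReal.ofReal_natCast, ← ENNReal.ofReal_mul (Nat.cast_nonneg m)]
  exact ENNReal.ofReal_le_ofReal (trace_le_mul_lambdaMax (isHermitian_priorFisher p))

end Joint

/-! ### The Bayesian Cramér–Rao inequality. -/

section CramerRao

variable {m D : ℕ} {Ω : Set (Eu m)} {p : Eu m → ℝ} {g : Eu m → Eu D} {S : Finset (Fin D)} {σ : ℝ}
  {A : Eu D → Eu m}

lemma hasLineDerivAt_likelihood {i : Fin m} {x : Eu m} (hx : x ∈ Ω)
    (hgd : ∀ j : Fin D, j ∉ S → HasPartial i (fun x' => g x' j) x) (u : Unenc S) :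
    HasLineDerivAt ℝ (fun x' => likelihood S σ (g x') u)
      (likelihood S σ (g x) u *
        ∑ j, (u j - g x j.1) * (jacobianEntry Ω g S i j x / σ ^ 2))
      x (EuclideanSpace.single i (1 : ℝ)) := by
  have hq : HasLineDerivAt ℝ (fun x' => ‖u - restrictOp S (g x')‖ ^ 2)
      (∑ j : {j : Fin D // j ∉ S}, 2 * (u j - g x j.1) * (-jacobianEntry Ω g S i j x)) x
      (EuclideanSpace.single i (1 : ℝ)) := by
    have h1 : ∀ j ∈ Finset.univ, HasDerivAt
        (fun t : ℝ => (u j - g (x + t • EuclideanSpace.single i (1 : ℝ)) j.1) ^ 2)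
        (2 * (u j - g x j.1) * (-jacobianEntry Ω g S i j x)) 0 := fun j _ => by
      have h : HasDerivAt (fun t : ℝ => g (x + t • EuclideanSpace.single i (1 : ℝ)) j.1)
          (partialDeriv i (fun x' => g x' j.1) x) 0 := (hgd j.1 j.2).hasLineDerivAt
      rw [jacobianEntry, Set.indicator_of_mem hx]
      generalize u j = c
      simpa using (h.const_sub c).fun_pow 2
    have h2 := HasDerivAt.fun_sum h1
    unfold HasLineDerivAt
    refine h2.congr_of_eventuallyEq (Eventually.of_forall fun t => ?_)
    simp only [EuclideanSpace.real_norm_sq_eq]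
    rfl
  have hφ : HasDerivAt (fun s : ℝ => (Real.sqrt (2 * Real.pi * σ ^ 2) ^ (D - S.card))⁻¹ *
      Real.exp (-s / (2 * σ ^ 2)))
      (likelihood S σ (g x) u * (-1 / (2 * σ ^ 2))) (‖u - restrictOp S (g x)‖ ^ 2) := by
    have h := ((((hasDerivAt_id (‖u - restrictOp S (g x)‖ ^ 2)).neg.div_const
      (2 * σ ^ 2)).exp).const_mul (Real.sqrt (2 * Real.pi * σ ^ 2) ^ (D - S.card))⁻¹)
    refine h.congr_deriv ?_
    rw [likelihood]
    exact (mul_assoc _ _ _).symm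
  have h : HasLineDerivAt ℝ (fun x' => likelihood S σ (g x') u) _ x _ :=
    hasLineDerivAt_comp (f := fun x' => ‖u - restrictOp S (g x')‖ ^ 2) hφ hq
  convert h using 1
  rw [Finset.mul_sum, Finset.mul_sum]
  refine Finset.sum_congr rfl fun j _ => ?_
  ring

/-- The product rule: differentiating the joint density gives the score term, and differentiating
A(Pu) - x in the same coordinate k gives the -1 that becomes the unit cross moment. -/
lemma hasLineDerivAt_weightedError (hp_pos : ∀ x ∈ Ω, 0 < p x) {k : Fin m} {x : Eu m}
    (hx : x ∈ Ω) (hpd : HasPartial k p x)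
    (hgd : ∀ j : Fin D, j ∉ S → HasPartial k (fun x' => g x' j) x) (u : Unenc S) :
    HasLineDerivAt ℝ (fun x' => weightedError p g S σ A k x' u)
      (jointDensity p g S σ (x, u) *
        (estimationError S A k (x, u) * jointScore Ω p g S σ k (x, u) - 1))
      x (EuclideanSpace.single k (1 : ℝ)) := by
  have h1 : HasDerivAt (fun t : ℝ => p (x + t • EuclideanSpace.single k (1 : ℝ)))
    (partialDeriv k p x) 0 := hpd.hasLineDerivAt
  have h2 : HasDerivAt (fun t : ℝ => likelihood S σ (g (x + t • EuclideanSpace.single k (1 : ℝ))) u)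
    _ 0 := hasLineDerivAt_likelihood (σ := σ) hx hgd u
  have h3 : HasDerivAt (fun t : ℝ =>
      (A (prolongOp S u) - (x + t • EuclideanSpace.single k (1 : ℝ))) k) (-1) 0 := by
    have : HasDerivAt (fun t : ℝ => A (prolongOp S u) k - (x k + t)) (-1) 0 :=
      ((hasDerivAt_id (0 : ℝ)).const_add (x k)).const_sub _
    simpa using this
  unfold HasLineDerivAt
  have h := (h1.mul h2).mul h3
  refine HasDerivAt.congr_deriv (f := fun t : ℝ =>
    weightedError p g S σ A k (x + t • EuclideanSpace.single k (1 : ℝ)) u) h ?_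
  have hpx := (hp_pos x hx).ne'
  simp only [jointDensity, estimationError, jointScore, priorScore, Set.indicator_of_mem hx,
    Pi.mul_apply, zero_smul, add_zero]
  field_simp
  ring

lemma density_nonneg (hp_pos : ∀ x ∈ Ω, 0 < p x) (hp_zero : ∀ x, x ∉ Ω → p x = 0) (x : Eu m) :
    0 ≤ p x := by
  by_cases hx : x ∈ Ω
  · exact (hp_pos x hx).le
  · exact (hp_zero x hx).ge

lemma jointDensity_nonneg (hσ : 0 < σ) (hp0 : ∀ x, 0 ≤ p x) (q : Eu m × Unenc S) :
    0 ≤ jointDensity p g S σ q :=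
  mul_nonneg (hp0 _) (likelihood_pos S hσ _ _).le

/-- A weighted function with finite second moment is integrable against products. -/
lemma integrable_weight_mul_mul {α : Type*} [MeasurableSpace α] {μ : Measure α} {w a b : α → ℝ}
    (hw : Measurable w) (hw0 : ∀ q, 0 ≤ w q) (ha : Measurable a) (hb : Measurable b)
    (hIa : Integrable (fun q => w q * a q ^ 2) μ) (hIb : Integrable (fun q => w q * b q ^ 2) μ) :
    Integrable (fun q => w q * (a q * b q)) μ := by
  refine (hIa.add hIb).mono (hw.mul (ha.mul hb)).aestronglyMeasurable
    (Eventually.of_forall fun q => ?_)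
  rw [Pi.add_apply, ← mul_add, norm_mul, norm_mul (w q) (a q ^ 2 + b q ^ 2),
    Real.norm_of_nonneg (hw0 q), Real.norm_of_nonneg (by positivity : 0 ≤ a q ^ 2 + b q ^ 2),
    Real.norm_eq_abs, abs_mul]
  refine mul_le_mul_of_nonneg_left ?_ (hw0 q)
  nlinarith [sq_nonneg (|a q| - |b q|), sq_abs (a q), sq_abs (b q), sq_nonneg (a q),
    sq_nonneg (b q)]

/-- Cross moment of the estimation error and the score, when the prior vanishes at the boundary. -/
theorem integral_error_mul_score_of_prior (hσ : 0 < σ) (hΩ : IsOpen Ω) (hp : Measurable p)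
    (hp_pos : ∀ x ∈ Ω, 0 < p x) (hp_zero : ∀ x, x ∉ Ω → p x = 0) (hg : Measurable g)
    (hA : Measurable A) {k : Fin m} (hpd : ∀ x ∈ Ω, HasPartial k p x)
    (hgd : ∀ x ∈ Ω, ∀ j : Fin D, j ∉ S → HasPartial k (fun x' => g x' j) x)
    (hb : ∀ x₀ ∈ frontier Ω, Tendsto p (𝓝[Ω] x₀) (𝓝 0))
    (hI : Integrable (fun q => jointDensity p g S σ q * estimationError S A k q)
      (volume.prod volume))
    (hI' : Integrable (fun q => jointDensity p g S σ q *
      (estimationError S A k q * jointScore Ω p g S σ k q - 1)) (volume.prod volume)) :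
    ∫ q, jointDensity p g S σ q *
      (estimationError S A k q * jointScore Ω p g S σ k q - 1) ∂(volume.prod volume) = 0 := by
  -- The x-integral is taken first, at fixed u, so that no derivative has to pass under the
  -- u-integral.
  rw [integral_prod_symm _ hI']
  refine integral_eq_zero_of_ae ?_
  filter_upwards [hI.prod_left_ae, hI'.prod_left_ae] with u hu hu'
  have hz : ∀ x, x ∉ Ω → jointDensity p g S σ (x, u) *
      (estimationError S A k (x, u) * jointScore Ω p g S σ k (x, u) - 1) = 0 := fun x hx => by
    simp [jointDensity, hp_zero x hx]
  rw [← setIntegral_eq_integral_of_forall_compl_eq_zero (s := Ω) hz]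
  refine setIntegral_lineDeriv_eq_zero hΩ (f := fun x => weightedError p g S σ A k x u)
    (v := EuclideanSpace.single k (1 : ℝ)) ?_ (fun x hx => by simp [weightedError, hp_zero x hx])
    (fun x hx => hasLineDerivAt_weightedError hp_pos hx (hpd x hx) (hgd x hx) u) ?_ hu
    hu'.integrableOn
  · exact ((measurable_jointDensity hp hg).mul (measurable_estimationError hA k)).comp
      measurable_prodMk_right
  · intro x₀ hx₀
    have h1 : Tendsto (fun x : Eu m => (A (prolongOp S u) - x) k) (𝓝[Ω] x₀)
        (𝓝 ((A (prolongOp S u) - x₀) k)) := by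
      have : Continuous fun x : Eu m => (A (prolongOp S u) - x) k := by fun_prop
      exact this.continuousAt.tendsto.mono_left nhdsWithin_le_nhds
    -- The likelihood is bounded uniformly in x, so p → 0 suffices however g behaves near the
    -- boundary.
    have h2 : Tendsto (fun x : Eu m => p x * likelihood S σ (g x) u) (𝓝[Ω] x₀) (𝓝 0) := by
      have h3 := (hb x₀ hx₀).mul_const (Real.sqrt (2 * Real.pi * σ ^ 2) ^ (D - S.card))⁻¹
      rw [zero_mul] at h3
      have hp0 := density_nonneg hp_pos hp_zero
      exact tendsto_of_tendsto_of_tendsto_of_le_of_le tendsto_const_nhds h3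
        (fun x => mul_nonneg (hp0 x) (likelihood_pos S hσ _ _).le)
        (fun x => mul_le_mul_of_nonneg_left (likelihood_le S hσ _ _) (hp0 x))
    have h3 := h2.mul h1
    rw [zero_mul] at h3
    exact h3

lemma integral_weightedError {x : Eu m} (hfin : Integrable
      fun u : Unenc S => likelihood S σ (g x) u • (A (prolongOp S u) - x)) (k : Fin m) :
    ∫ u, weightedError p g S σ A k x u = (p x • bias g S σ A x) k := by
  have h := (EuclideanSpace.proj (𝕜 := ℝ) k : Eu m →L[ℝ] ℝ).integral_comp_comm hfin
  have h' : (bias g S σ A x) k = ∫ u, likelihood S σ (g x) u * (A (prolongOp S u) - x) k := by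
    simpa [bias] using h.symm
  rw [PiLp.smul_apply, h', smul_eq_mul, ← integral_const_mul]
  simp only [weightedError, mul_assoc]

/-- Cross moment of the estimation error and the score, for a regular estimator. -/
theorem integral_error_mul_score_of_regular (hΩ : IsOpen Ω) (hp : Measurable p)
    (hp_pos : ∀ x ∈ Ω, 0 < p x) (hp_zero : ∀ x, x ∉ Ω → p x = 0) (hg : Measurable g)
    (hA : RegularEstimator Ω p g S σ A) {k : Fin m} (hpd : ∀ x ∈ Ω, HasPartial k p x)
    (hgd : ∀ x ∈ Ω, ∀ j : Fin D, j ∉ S → HasPartial k (fun x' => g x' j) x)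
    (hI : Integrable (fun q => jointDensity p g S σ q * estimationError S A k q)
      (volume.prod volume))
    (hI' : Integrable (fun q => jointDensity p g S σ q *
      (estimationError S A k q * jointScore Ω p g S σ k q - 1)) (volume.prod volume)) :
    ∫ q, jointDensity p g S σ q *
      (estimationError S A k q * jointScore Ω p g S σ k q - 1) ∂(volume.prod volume) = 0 := by
  -- Here u is integrated first; the interchange hypothesis identifies the inner integral as the
  -- x-derivative of p B_k.
  rw [integral_prod _ hI']
  have hz : ∀ x, x ∉ Ω → ∫ u, jointDensity p g S σ (x, u) *
      (estimationError S A k (x, u) * jointScore Ω p g S σ k (x, u) - 1) = 0 := fun x hx => by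
    simp [jointDensity, hp_zero x hx]
  rw [← setIntegral_eq_integral_of_forall_compl_eq_zero (s := Ω) hz]
  refine setIntegral_lineDeriv_eq_zero hΩ (f := fun x => ∫ u, weightedError p g S σ A k x u)
    (v := EuclideanSpace.single k (1 : ℝ)) ?_ (fun x hx => by simp [weightedError, hp_zero x hx])
    ?_ ?_ hI.integral_prod_left hI'.integral_prod_left.integrableOn
  · have hm : Measurable fun q => jointDensity p g S σ q * estimationError S A k q :=
      (measurable_jointDensity hp hg).mul (measurable_estimationError hA.measurable k)
    exact hm.stronglyMeasurable.integral_prod_right.measurable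
  · intro x hx
    have h := hA.interchange x hx k k
    have e : ∀ u, partialDeriv k (fun x' => weightedError p g S σ A k x' u) x =
        jointDensity p g S σ (x, u) *
          (estimationError S A k (x, u) * jointScore Ω p g S σ k (x, u) - 1) := fun u =>
      (hasLineDerivAt_weightedError hp_pos hx (hpd x hx) (hgd x hx) u).lineDeriv
    simp_rw [e] at h
    exact h
  · intro x₀ hx₀
    have h := ((EuclideanSpace.proj (𝕜 := ℝ) k : Eu m →L[ℝ] ℝ).continuous.tendsto 0).comp
      (hA.boundary x₀ hx₀)
    rw [map_zero] at h
    refine h.congr' ?_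
    filter_upwards [self_mem_nhdsWithin] with x hx
    exact (integral_weightedError (hA.finite_bias x hx) k).symm

/-- The Cauchy–Schwarz step of the Bayesian Cramér–Rao inequality. -/
theorem sq_le_mul_of_cross_moment {α : Type*} [MeasurableSpace α] {μ : Measure α}
    {w : α → ℝ} {e s : Fin m → α → ℝ} (hw0 : ∀ q, 0 ≤ w q)
    (he : ∀ k, Integrable (fun q => w q * e k q ^ 2) μ)
    (hs : ∀ k, Integrable (fun q => w q * s k q ^ 2) μ)
    (hes : ∀ k, Integrable (fun q => w q * (e k q * s k q)) μ)
    (hcross : ∀ k, ∫ q, w q * (e k q * s k q) ∂μ = 1) :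
    (m : ℝ) ^ 2 ≤ (∑ k, ∫ q, w q * e k q ^ 2 ∂μ) * ∑ k, ∫ q, w q * s k q ^ 2 ∂μ := by
  -- This quadratic in t is Σ_k ∫ w (t e_k - s_k)²; each unit cross moment contributes -2t, and
  -- nonnegativity forces a nonpositive discriminant.
  have hquad : ∀ t : ℝ, 0 ≤ (∑ k, ∫ q, w q * e k q ^ 2 ∂μ) * (t * t) + (-2 * m) * t +
      ∑ k, ∫ q, w q * s k q ^ 2 ∂μ := by
    intro t
    have hk : ∀ k, ∫ q, w q * (t * e k q - s k q) ^ 2 ∂μ =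
        (∫ q, w q * e k q ^ 2 ∂μ) * (t * t) + -2 * t + ∫ q, w q * s k q ^ 2 ∂μ := fun k => by
      have hexp : ∀ q, w q * (t * e k q - s k q) ^ 2 =
          (w q * e k q ^ 2) * (t * t) + (w q * (e k q * s k q)) * (-2 * t) + w q * s k q ^ 2 :=
        fun q => by ring
      simp_rw [hexp]
      have h1 := (he k).mul_const (t * t)
      have h2 := (hes k).mul_const (-2 * t)
      have h12 : Integrable (fun q => (w q * e k q ^ 2) * (t * t) +
        (w q * (e k q * s k q)) * (-2 * t)) μ := h1.add h2
      rw [integral_add h12 (hs k), integral_add h1 h2, integral_mul_const, integral_mul_const,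
        hcross, one_mul]
    have hnn : 0 ≤ ∑ k, ∫ q, w q * (t * e k q - s k q) ^ 2 ∂μ :=
      Finset.sum_nonneg fun k _ => integral_nonneg fun q => mul_nonneg (hw0 q) (sq_nonneg _)
    simp_rw [hk] at hnn
    rw [Finset.sum_add_distrib, Finset.sum_add_distrib, ← Finset.sum_mul] at hnn
    simp only [Finset.sum_const, Finset.card_univ, Fintype.card_fin, nsmul_eq_mul] at hnn
    linarith
  have h := discrim_le_zero hquad
  rw [discrim] at h
  linarith

/-- The Bayesian Cramér–Rao bound, given the integration by parts formula. -/
theorem privacyBound_le_of_integration_by_parts (hσ : 0 < σ) (hΩ : IsOpen Ω) (hp : Measurable p)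
    (hp_pos : ∀ x ∈ Ω, 0 < p x) (hp_zero : ∀ x, x ∉ Ω → p x = 0)
    (hprob : IsProbabilityMeasure (dataLaw p)) (hg : Measurable g) (hA : Measurable A)
    (hpd : ∀ x ∈ Ω, ∀ i, HasPartial i p x)
    (hgd : ∀ x ∈ Ω, ∀ i, ∀ j : Fin D, j ∉ S → HasPartial i (fun x' => g x' j) x)
    (hJ : ∀ i, Integrable (fun x => score p i x ^ 2) (dataLaw p))
    (hparts : ∀ k : Fin m,
      Integrable (fun q => jointDensity p g S σ q * estimationError S A k q)
        (volume.prod volume) →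
      Integrable (fun q => jointDensity p g S σ q *
        (estimationError S A k q * jointScore Ω p g S σ k q - 1)) (volume.prod volume) →
      ∫ q, jointDensity p g S σ q *
        (estimationError S A k q * jointScore Ω p g S σ k q - 1) ∂(volume.prod volume) = 0) :
    privacyBound p g S σ ≤ meanSquaredError p g S σ A := by
  rw [privacyBound]
  set den := ENNReal.ofReal ((D : ℝ) * (1 - encryptionRatio S) / σ ^ 2) *
        (∫⁻ x, ENNReal.ofReal (maxNormSq (restrictedJacobian g S x)) ∂(dataLaw p)) +
      ENNReal.ofReal (lambdaMax (priorFisher p)) with hden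
  rcases eq_or_ne (meanSquaredError p g S σ A) ⊤ with hM | hM
  · rw [hM]; exact le_top
  rcases eq_or_ne den ⊤ with hd | hd
  · rw [hd, ENNReal.div_top]; exact zero_le
  rcases Nat.eq_zero_or_pos m with hm0 | hm0
  · simp [hm0]
  -- A zero denominator needs no separate case: the product inequality proved below would then force
  -- m = 0, so for m > 0 the error cannot be finite.
  refine ENNReal.div_le_of_le_mul ?_
  have hp0 := density_nonneg hp_pos hp_zero
  have hfisher := sum_lintegral_jointScore_sq_le (σ := σ) hσ hΩ hp hp_pos hp_zero hg hpd hgd hJ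
  rw [← hden] at hfisher
  have hMSE := meanSquaredError_eq_lintegral (S := S) hσ hp hp0 hg hA
  set w := jointDensity p g S σ
  set e := estimationError S A
  set s := jointScore Ω p g S σ
  have hw0 : ∀ q, 0 ≤ w q := jointDensity_nonneg hσ hp0
  have hwm : Measurable w := measurable_jointDensity hp hg
  have hem : ∀ k, Measurable (e k) := measurable_estimationError hA
  have hsm : ∀ k, Measurable (s k) := fun k =>
    measurable_jointScore hΩ hp hg (fun x hx => hpd x hx k) fun x hx => hgd x hx k
  have hMSE' : meanSquaredError p g S σ A =
      ∑ k, ∫⁻ q, ENNReal.ofReal (w q * e k q ^ 2) ∂(volume.prod volume) := by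
    have hmeas : ∀ k ∈ Finset.univ, Measurable fun q => ENNReal.ofReal (w q * e k q ^ 2) :=
      fun k _ => (hwm.mul ((hem k).pow_const 2)).ennreal_ofReal
    rw [hMSE, ← lintegral_finsetSum _ hmeas]
    refine lintegral_congr fun q => ?_
    rw [← ENNReal.ofReal_mul (hw0 q), Finset.mul_sum,
      ENNReal.ofReal_sum_of_nonneg fun k _ => mul_nonneg (hw0 q) (sq_nonneg _)]
  have hfisher' : ∑ k, ∫⁻ q, ENNReal.ofReal (w q * s k q ^ 2) ∂(volume.prod volume) ≤
      m * den := by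
    refine le_trans (le_of_eq (Finset.sum_congr rfl fun k _ => lintegral_congr fun q => ?_)) hfisher
    rw [ENNReal.ofReal_mul (hw0 q)]
  have hint : ∀ f : Eu m × Unenc S → ℝ, Measurable f →
      ∫⁻ q, ENNReal.ofReal (w q * f q ^ 2) ∂(volume.prod volume) ≠ ⊤ →
      Integrable (fun q => w q * f q ^ 2) (volume.prod volume) := fun f hf h =>
    (lintegral_ofReal_ne_top_iff_integrable (hwm.mul (hf.pow_const 2)).aestronglyMeasurable
      (Eventually.of_forall fun q => mul_nonneg (hw0 q) (sq_nonneg _))).1 h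
  have he : ∀ k, Integrable (fun q => w q * e k q ^ 2) (volume.prod volume) := fun k =>
    hint _ (hem k) (ENNReal.sum_ne_top.1 (hMSE' ▸ hM) k (Finset.mem_univ k))
  have hs : ∀ k, Integrable (fun q => w q * s k q ^ 2) (volume.prod volume) := fun k =>
    hint _ (hsm k) (ENNReal.sum_ne_top.1
      (ne_top_of_le_ne_top (ENNReal.mul_ne_top (ENNReal.natCast_ne_top m) hd) hfisher')
      k (Finset.mem_univ k))
  have hes : ∀ k, Integrable (fun q => w q * (e k q * s k q)) (volume.prod volume) := fun k =>
    integrable_weight_mul_mul hwm hw0 (hem k) (hsm k) (he k) (hs k)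
  have hone := lintegral_jointDensity (S := S) hσ hp hp0 hg hprob
  have hw : Integrable w (volume.prod volume) :=
    (lintegral_ofReal_ne_top_iff_integrable hwm.aestronglyMeasurable
      (Eventually.of_forall hw0)).1 (by rw [hone]; exact ENNReal.one_ne_top)
  have hw1 : ∫ q, w q ∂(volume.prod volume) = 1 := by
    rw [integral_eq_lintegral_of_nonneg_ae (Eventually.of_forall hw0) hwm.aestronglyMeasurable,
      hone, ENNReal.toReal_one]
  -- First moments are finite by pairing the error with the constant 1, whose second moment is the
  -- total mass.
  have hwe : ∀ k, Integrable (fun q => w q * e k q) (volume.prod volume) := fun k => by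
    simpa using integrable_weight_mul_mul (b := fun _ => 1) hwm hw0 (hem k) measurable_const (he k)
      (by simpa using hw)
  have hsub : ∀ k q, w q * (e k q * s k q - 1) = w q * (e k q * s k q) - w q := fun k q => by ring
  have hcross : ∀ k, ∫ q, w q * (e k q * s k q) ∂(volume.prod volume) = 1 := fun k => by
    have h := hparts k (hwe k) (by simp_rw [hsub]; exact (hes k).sub hw)
    simp_rw [hsub] at h
    rw [integral_sub (hes k) hw, hw1] at h
    linarith
  have hCS := sq_le_mul_of_cross_moment hw0 he hs hes hcross
  have hlint : ∀ f : Fin m → Eu m × Unenc S → ℝ,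
      (∀ k, Integrable (fun q => w q * f k q ^ 2) (volume.prod volume)) →
      ENNReal.ofReal (∑ k, ∫ q, w q * f k q ^ 2 ∂(volume.prod volume)) =
        ∑ k, ∫⁻ q, ENNReal.ofReal (w q * f k q ^ 2) ∂(volume.prod volume) := fun f hf => by
    have hnn : ∀ k q, 0 ≤ w q * f k q ^ 2 := fun k q => mul_nonneg (hw0 q) (sq_nonneg _)
    rw [ENNReal.ofReal_sum_of_nonneg fun k _ => integral_nonneg (hnn k)]
    exact Finset.sum_congr rfl fun k _ =>
      ofReal_integral_eq_lintegral_ofReal (hf k) (Eventually.of_forall (hnn k))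
  -- One m on the right comes from summing the Fisher information over coordinates; cancelling it
  -- leaves the numerator m of β rather than m².
  have hfinal : (m : ℝ≥0∞) * m ≤ m * (meanSquaredError p g S σ A * den) := by
    calc (m : ℝ≥0∞) * m = ENNReal.ofReal ((m : ℝ) ^ 2) := by
          rw [ENNReal.ofReal_pow (Nat.cast_nonneg m), ENNReal.ofReal_natCast, pow_two]
      _ ≤ _ := ENNReal.ofReal_le_ofReal hCS
      _ = meanSquaredError p g S σ A *
          ∑ k, ∫⁻ q, ENNReal.ofReal (w q * s k q ^ 2) ∂(volume.prod volume) := by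
          rw [ENNReal.ofReal_mul (Finset.sum_nonneg fun k _ =>
            integral_nonneg fun q => mul_nonneg (hw0 q) (sq_nonneg _)), hlint e he, hlint s hs,
            hMSE']
      _ ≤ meanSquaredError p g S σ A * (m * den) := by gcongr
      _ = m * (meanSquaredError p g S σ A * den) := by ring
  exact (ENNReal.mul_le_mul_iff_right (by exact_mod_cast hm0.ne') (ENNReal.natCast_ne_top m)).1
    hfinal

end CramerRao

end SelectiveEncryption

end

theorem theorem1 {m D : ℕ}
    -- the loss `L(θ, x)`, the current parameter `θ`, the encrypted coordinates, the noise level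
    (L : Eu D → Eu m → ℝ) (θ : Eu D) (S : Finset (Fin D)) (σ : ℝ) (hσ : 0 < σ)
    -- the data density `p`, positive exactly on the open region `Ω`
    (Ω : Set (Eu m)) (hΩ : IsOpen Ω) (p : Eu m → ℝ) (hp_meas : Measurable p)
    (hp_pos : ∀ x ∈ Ω, 0 < p x) (hp_zero : ∀ x, x ∉ Ω → p x = 0)
    (hp_prob : IsProbabilityMeasure (dataLaw p))
    -- existence of the gradient `g = ∇_θ L` and of the partial derivatives of `p` and `R g`
    (hL : ∀ x ∈ Ω, DifferentiableAt ℝ (fun θ' => L θ' x) θ)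
    (hg_meas : Measurable (modelGradient L θ))
    (hp_diff : ∀ x ∈ Ω, ∀ i : Fin m, HasPartial i p x)
    (hg_diff : ∀ x ∈ Ω, ∀ i : Fin m, ∀ j : Fin D, j ∉ S →
      HasPartial i (fun x' => modelGradient L θ x' j) x)
    -- the prior Fisher information is finite
    (hJP : ∀ i : Fin m, Integrable (fun x => score p i x ^ 2) (dataLaw p)) :
    -- `E_A` over all estimators, if `p` vanishes at the boundary (no condition if `Ω = ℝ^m`)
    ((∀ x₀ ∈ frontier Ω, Tendsto p (𝓝[Ω] x₀) (𝓝 0)) →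
      privacyBound p (modelGradient L θ) S σ ≤
        reconstructionError p (modelGradient L θ) S σ) ∧
    -- the error of each estimator that satisfies the regularity conditions itself
    (∀ A : Eu D → Eu m, RegularEstimator Ω p (modelGradient L θ) S σ A →
      privacyBound p (modelGradient L θ) S σ ≤
        meanSquaredError p (modelGradient L θ) S σ A) := by
  refine ⟨fun hb => le_iInf₂ fun A hA => ?_, fun A hA => ?_⟩
  · exact privacyBound_le_of_integration_by_parts hσ hΩ hp_meas hp_pos hp_zero hp_prob hg_meas hA
      hp_diff hg_diff hJP fun k hI hI' =>
        integral_error_mul_score_of_prior hσ hΩ hp_meas hp_pos hp_zero hg_meas hA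
          (fun x hx => hp_diff x hx k) (fun x hx => hg_diff x hx k) hb hI hI'
  · exact privacyBound_le_of_integration_by_parts hσ hΩ hp_meas hp_pos hp_zero hp_prob hg_meas
      hA.measurable hp_diff hg_diff hJP fun k hI hI' =>
        integral_error_mul_score_of_regular hΩ hp_meas hp_pos hp_zero hg_meas hA
          (fun x hx => hp_diff x hx k) (fun x hx => hg_diff x hx k) hI hI'
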